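/- Let $F$ be a field of arbitrary characteristic with a non-trivial involution $c$, i.e. a field automorphism $c:\alpha\mapsto\alpha^c$ of $F$ with $c\circ c=\mathrm{id}$ and $c\neq\mathrm{id}$. Let $V$ be a finite-dimensional vector space over $F$ and let $T:V\to V$ be an invertible linear map. A $c$-hermitian form on $V$ is a bi-additive map $\sigma:V\times V\to F$ with $\sigma(\alpha v,\beta w)=\alpha\beta^c\sigma(v,w)$ and $\sigma(v,w)=\sigma(w,v)^c$ for all $\alpha,\beta\in F$ and $v,w\in V$; it is $T$-invariant if $\sigma(Tv,Tw)=\sigma(v,w)$ for all $v,w\in V$. The pair $(V,T)$ is isomorphic to a finite direct sum of pairs $(F[x]/(p(x)^k),\ \text{multiplication by }x)$ with $p$ monic irreducible and $k\ge 1$; the polynomials $p(x)^k$ that occur are the elementary divisors of $T$, and the multiplicity of an elementary divisor is the number of times it occurs (the list is unique up to order). The dual of a monic polynomial $f(x)=\sum_{i=0}^d a_ix^i$ of degree $d$ with $a_0\neq 0$ is $f^*(x)=\frac{1}{a_0^c}\sum_{i=0}^d a_{d-i}^c\,x^i$, and $f$ is called self-dual if $f=f^*$ or $f$ is a power of $x-1$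 or of $x+1$. Then $V$ admits a $T$-invariant non-degenerate $c$-hermitian form if and only if, for every elementary divisor $f$ of $T$, either $f$ is self-dual, or $f^*$ is also an elementary divisor of $T$, with the same multiplicity as $f$. -/

import Mathlib

open Polynomial

/-- The dual of `f = ∑ aᵢ xⁱ` (of degree `d`, with nonzero constant term) with respect to `c`:
`f* = c(a₀)⁻¹ ∑ c(a_{d-i}) xⁱ`, that is `c(f(0))⁻¹ x^d f^c(x⁻¹)`. -/
noncomputable def dualPoly {F : Type*} [Field F] (c : F ≃+* F) (f : F[X]) : F[X] :=
  C (c (f.coeff 0))⁻¹ * (f.map (c : F →+* F)).reverse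

/-- A polynomial is self-dual if it is a power of `x - 1` or `x + 1`, or equals its dual. -/
def IsSelfDualPoly {F : Type*} [Field F] (c : F ≃+* F) (f : F[X]) : Prop :=
  (∃ k : ℕ, f = (X - 1) ^ k) ∨ (∃ k : ℕ, f = (X + 1) ^ k) ∨ f = dualPoly c f

/-- `S` is the multiset of the polynomials `p ^ k` occurring in some decomposition of `(V, T)` into
a direct sum of pairs `(F[x] / (p ^ k), multiplication by x)`, with `p` monic irreducible and
`k ≥ 1`. -/
def IsElementaryDivisors {F V : Type*} [Field F] [AddCommGroup V] [Module F V]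
    (T : V →ₗ[F] V) (S : Multiset F[X]) : Prop :=
  ∃ (n : ℕ) (q : Fin n → F[X]),
    S = (Finset.univ : Finset (Fin n)).val.map q ∧
    (∀ i, ∃ (p : F[X]) (k : ℕ), p.Monic ∧ Irreducible p ∧ 1 ≤ k ∧ q i = p ^ k) ∧
    ∃ e : V ≃ₗ[F] (∀ i, AdjoinRoot (q i)),
      ∀ v i, e (T v) i = AdjoinRoot.root (q i) * e v i

theorem exists_isElementaryDivisors {F V : Type*} [Field F] [AddCommGroup V] [Module F V]
    [FiniteDimensional F V] (T : V →ₗ[F] V) : ∃ S, IsElementaryDivisors T S := by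
  classical
  obtain ⟨ι, _, p, hp, k, ⟨φ⟩⟩ := Module.equiv_directSum_of_isTorsion
    (Module.AEval.isTorsion_of_finiteDimensional F V T)
  let J := {i : ι // k i ≠ 0}
  let n := Fintype.card J
  let ε : Fin n ≃ J := (Fintype.equivFin J).symm
  let q : Fin n → F[X] := fun j => (normalize (p (ε j))) ^ k (ε j)
  have hspan : ∀ j, Ideal.span {p (ε j) ^ k (ε j)} = Ideal.span {q j} := fun j =>
    Ideal.span_singleton_eq_span_singleton.2 ((associated_normalize _).pow_pow)
  let Φ : (∀ i : ι, F[X] ⧸ Ideal.span {p i ^ k i}) →ₗ[F[X]] ∀ j, F[X] ⧸ Ideal.span {q j} :=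
    LinearMap.pi fun j =>
      (Submodule.quotEquivOfEq _ _ (hspan j)).toLinearMap ∘ₗ LinearMap.proj (ε j : ι)
  have hΦ : Function.Bijective Φ := by
    constructor
    · intro a b hab
      funext i
      by_cases hi : k i = 0
      · have : Subsingleton (F[X] ⧸ Ideal.span {p i ^ k i}) :=
          Ideal.Quotient.subsingleton_iff.2 (by simp [hi])
        exact Subsingleton.elim _ _
      · have h := congrFun hab (ε.symm ⟨i, hi⟩)
        have h2 := (Submodule.quotEquivOfEq _ _ (hspan (ε.symm ⟨i, hi⟩))).injective h
        have h3 : ∀ x : J, x = ⟨i, hi⟩ → a x = b x → a i = b i := by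
          rintro x rfl h; exact h
        exact h3 _ (ε.apply_symm_apply _) h2
    · intro b
      have key : ∀ i : ι, ∃ x : F[X] ⧸ Ideal.span {p i ^ k i}, ∀ j (h : (ε j : ι) = i),
          Submodule.quotEquivOfEq _ _ (hspan j) (h ▸ x) = b j := by
        intro i
        by_cases hi : k i = 0
        · exact ⟨0, fun j h => absurd hi (h ▸ (ε j).2)⟩
        · obtain ⟨j, hj⟩ := ε.surjective ⟨i, hi⟩
          obtain rfl : (ε j : ι) = i := by rw [hj]
          refine ⟨(Submodule.quotEquivOfEq _ _ (hspan j)).symm (b j), fun j' h => ?_⟩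
          obtain rfl : j' = j := ε.injective (Subtype.ext h)
          simp
      choose a ha using key
      exact ⟨a, funext fun j => ha _ j rfl⟩
  let Ψ := (φ.trans (DirectSum.linearEquivFunOnFintype F[X] ι _)).trans
    (LinearEquiv.ofBijective Φ hΦ)
  refine ⟨_, n, q, rfl, fun j => ⟨_, _, Polynomial.monic_normalize (hp _).ne_zero,
    (associated_normalize _).irreducible_iff.1 (hp _), Nat.one_le_iff_ne_zero.2 (ε j).2, rfl⟩, ?_⟩
  have hof : ∀ v, Module.AEval'.of T (T v) = (X : F[X]) • Module.AEval'.of T v := fun v =>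
    (Module.AEval'.X_smul_of T v).symm
  have hC : ∀ (a : F) v, Module.AEval'.of T (a • v) = (C a : F[X]) • Module.AEval'.of T v := by
    intro a v
    rw [map_smul, Module.AEval.C_smul]
  have hmul : ∀ (f : F[X]) j (y : F[X] ⧸ Ideal.span {q j}),
      @Eq (AdjoinRoot (q j)) (f • y)
        (@HMul.hMul (AdjoinRoot (q j)) (AdjoinRoot (q j)) (AdjoinRoot (q j)) _
          (AdjoinRoot.mk (q j) f) y) := by
    intro f j y
    obtain ⟨y, rfl⟩ := Ideal.Quotient.mk_surjective y
    rfl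
  refine ⟨{ toFun := fun v => Ψ (Module.AEval'.of T v)
            map_add' := fun v w => by rw [map_add, map_add]; rfl
            map_smul' := fun a v => ?_
            invFun := fun y => (Module.AEval'.of T).symm (Ψ.symm y)
            left_inv := fun v => by
              change (Module.AEval'.of T).symm (Ψ.symm (Ψ (Module.AEval'.of T v))) = v
              simp
            right_inv := fun y => by
              change Ψ (Module.AEval'.of T ((Module.AEval'.of T).symm (Ψ.symm y))) = y
              rw [LinearEquiv.apply_symm_apply]
              exact Ψ.apply_symm_apply y }, fun v j => ?_⟩
  · rw [hC, map_smul]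
    funext j
    refine (hmul _ j _).trans ?_
    exact (Algebra.smul_def a _).symm
  · change Ψ (Module.AEval'.of T (T v)) j = _
    rw [hof, map_smul]
    exact hmul _ j _

/-- The multiset of elementary divisors of `T`, each repeated according to its multiplicity
(by the structure theory of linear operators it does not depend on the chosen decomposition). -/
noncomputable def elementaryDivisors {F V : Type*} [Field F] [AddCommGroup V] [Module F V]
    [FiniteDimensional F V] (T : V →ₗ[F] V) : Multiset F[X] :=
  (exists_isElementaryDivisors T).choose

open Classical in
/-- The multiplicity of `f` as an elementary divisor of `T`. -/
noncomputable def elementaryDivisorMultiplicity {F V : Type*} [Field F] [AddCommGroup V]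
    [Module F V] [FiniteDimensional F V] (T : V →ₗ[F] V) (f : F[X]) : ℕ :=
  (elementaryDivisors T).count f

/-- A form that is linear in the first and `c`-semilinear in the second variable is
`c`-hermitian if `σ(v, w) = σ(w, v)^c`. -/
def IsHermitianForm {F V : Type*} [Field F] [AddCommGroup V] [Module F V] (c : F ≃+* F)
    (σ : V →ₗ[F] V →ₛₗ[(c : F →+* F)] F) : Prop :=
  ∀ v w, σ v w = c (σ w v)

def IsInvariantForm {F V : Type*} [Field F] [AddCommGroup V] [Module F V] {c : F ≃+* F}
    (T : V →ₗ[F] V) (σ : V →ₗ[F] V →ₛₗ[(c : F →+* F)] F) : Prop :=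
  ∀ v w, σ (T v) (T w) = σ v w

/-! Necessity. Invariance makes `T⁻¹` the adjoint of `T`, so `g(T)` has adjoint `g^c(T⁻¹)`, which is
`g*(T)` up to a scalar and a power of `T`. Hence `σ` embeds `ker g*(T)` in the annihilator of the
range of `g(T)`, and since `g** = g` the kernels of `g(T)` and `g*(T)` have equal dimension
(`finrank_ker_aeval_dualPoly`). The multiplicity of `p^k` is the second difference of `j ↦ dim ker
p^j(T)` up to sign and the factor `deg p` (`two_mul_finrank_ker_aeval`), so `f` and `f*` have the
same multiplicity.

Sufficiency. Equal multiplicities give an involution `π` of the summands with `q (π i) = (q i)*`.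
Summands `i` and `π i` are paired by `l (x * J y)`, where `J` extends `c` and inverts `x`. In
`F[x]/(p^(k+1))` every nonzero ideal contains `p^k`, so `l (p^k) ≠ 0` suffices for non-degeneracy.
When `π i = i` the pairing must itself be hermitian; `c ≠ id` allows `l` to be symmetrised without
losing `l (p^k) ≠ 0`, in every characteristic. -/

/-! ### Duals of polynomials -/

section Dual

variable {F : Type*} [Field F] (c : F ≃+* F)

theorem coeff_dualPoly (f : F[X]) (n : ℕ) :
    (dualPoly c f).coeff n = (c (f.coeff 0))⁻¹ * c (f.coeff (revAt f.natDegree n)) := by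
  rw [dualPoly, coeff_C_mul, coeff_reverse, coeff_map, natDegree_map]
  rfl

theorem dualPoly_mul (f g : F[X]) : dualPoly c (f * g) = dualPoly c f * dualPoly c g := by
  simp only [dualPoly, mul_coeff_zero, map_mul, mul_inv, Polynomial.map_mul,
    reverse_mul_of_domain]
  ring

theorem dualPoly_one : dualPoly c (1 : F[X]) = 1 := by
  simp only [dualPoly, coeff_one_zero, map_one, inv_one, Polynomial.map_one, one_mul]
  rw [← C_1, reverse_C]

theorem dualPoly_pow (f : F[X]) (k : ℕ) : dualPoly c (f ^ k) = dualPoly c f ^ k := by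
  induction k with
  | zero => simp [dualPoly_one]
  | succ k ih => rw [pow_succ, dualPoly_mul, ih, pow_succ]

variable {c}

theorem natDegree_dualPoly {f : F[X]} (h0 : f.coeff 0 ≠ 0) :
    (dualPoly c f).natDegree = f.natDegree := by
  have h1 : (c (f.coeff 0))⁻¹ ≠ 0 := inv_ne_zero ((map_ne_zero c).2 h0)
  have h2 : (f.map (c : F →+* F)).coeff 0 ≠ 0 := by
    rw [coeff_map]; exact (map_ne_zero (c : F →+* F)).2 h0
  rw [dualPoly, natDegree_C_mul h1, reverse_natDegree, natDegree_map,
    natTrailingDegree_eq_zero.2 (Or.inr h2), Nat.sub_zero]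

theorem monic_dualPoly {f : F[X]} (h0 : f.coeff 0 ≠ 0) : (dualPoly c f).Monic := by
  rw [Monic, leadingCoeff, natDegree_dualPoly h0, coeff_dualPoly, revAt_le le_rfl, Nat.sub_self]
  exact inv_mul_cancel₀ ((map_ne_zero c).2 h0)

theorem coeff_zero_dualPoly {f : F[X]} (hf : f.Monic) :
    (dualPoly c f).coeff 0 = (c (f.coeff 0))⁻¹ := by
  rw [coeff_dualPoly, revAt_zero, hf.coeff_natDegree, map_one, mul_one]

theorem coeff_zero_dualPoly_ne_zero {f : F[X]} (hf : f.Monic) (h0 : f.coeff 0 ≠ 0) :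
    (dualPoly c f).coeff 0 ≠ 0 := by
  rw [coeff_zero_dualPoly hf]
  exact inv_ne_zero ((map_ne_zero c).2 h0)

theorem dualPoly_dualPoly (hc : ∀ a, c (c a) = a) {f : F[X]} (hf : f.Monic)
    (h0 : f.coeff 0 ≠ 0) : dualPoly c (dualPoly c f) = f := by
  ext n
  rw [coeff_dualPoly, natDegree_dualPoly h0, coeff_zero_dualPoly hf, coeff_dualPoly, revAt_invol]
  simp only [map_mul, map_inv₀, hc, inv_inv]
  rw [mul_inv_cancel_left₀ h0]

/-- Duality is multiplicative and preserves degrees, so a factorisation of `p*` dualises to one of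
`p`. -/
theorem irreducible_dualPoly (hc : ∀ a, c (c a) = a) {p : F[X]} (hp : p.Monic)
    (h0 : p.coeff 0 ≠ 0) (hi : Irreducible p) : Irreducible (dualPoly c p) := by
  refine (monic_dualPoly h0).irreducible_iff_natDegree.2 ⟨fun h => ?_, fun f g hf hg hfg => ?_⟩
  · have := dualPoly_dualPoly hc hp h0
    rw [h, dualPoly_one] at this
    exact hi.ne_one this.symm
  · have hfg0 : f.coeff 0 * g.coeff 0 ≠ 0 := by
      rw [← mul_coeff_zero, hfg]
      exact coeff_zero_dualPoly_ne_zero hp h0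
    have hf0 := left_ne_zero_of_mul hfg0
    have hg0 := right_ne_zero_of_mul hfg0
    have hpe : dualPoly c f * dualPoly c g = p := by
      rw [← dualPoly_mul, hfg, dualPoly_dualPoly hc hp h0]
    have := (hp.irreducible_iff_natDegree.1 hi).2 _ _ (monic_dualPoly hf0) (monic_dualPoly hg0) hpe
    rwa [natDegree_dualPoly hf0, natDegree_dualPoly hg0] at this

theorem dualPoly_X_add_C {a : F} (ha : a * c a = 1) : dualPoly c (X + C a) = X + C a := by
  have h : c a ≠ 0 := right_ne_zero_of_mul_eq_one ha
  have hr : reverse (X + C (c a) : F[X]) = 1 + C (c a) * X := by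
    rw [reverse_add_C, natDegree_X, pow_one]
    have := reverse_mul_X (1 : F[X])
    rw [one_mul, ← C_1, reverse_C] at this
    rw [this, C_1]
  rw [dualPoly, Polynomial.map_add, map_X, map_C]
  simp only [coeff_add, coeff_X_zero, coeff_C_zero, zero_add]
  erw [hr]
  rw [mul_add, mul_one, ← mul_assoc, ← C_mul, inv_mul_cancel₀ h, C_1, one_mul, add_comm,
    inv_eq_of_mul_eq_one_left ha]

/-- Powers of `x ± 1` equal their own duals, so the first two alternatives of `IsSelfDualPoly` add
nothing. -/
theorem IsSelfDualPoly.dualPoly_eq {f : F[X]} (h : IsSelfDualPoly c f) : dualPoly c f = f := by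
  obtain ⟨k, rfl⟩ | ⟨k, rfl⟩ | h := h
  · rw [dualPoly_pow, sub_eq_add_neg, ← C_1, ← C_neg, dualPoly_X_add_C (by simp)]
  · rw [dualPoly_pow, ← C_1, dualPoly_X_add_C (by simp)]
  · exact h.symm

end Dual

/-! ### Kernels of multiplication on a cyclic module -/

section Kernel

theorem AdjoinRoot.finrank_eq_natDegree {F : Type*} [Field F] {q : F[X]} (hq : q ≠ 0) :
    Module.finrank F (AdjoinRoot q) = q.natDegree := by
  rw [(AdjoinRoot.powerBasis hq).finrank, AdjoinRoot.powerBasis_dim]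

/-- Here `d` is a gcd of `g` and `q`. By Bézout the image of multiplication by `g` is the kernel of
`F[x]/(q) → F[x]/(d)`; rank-nullity for both maps gives the dimension. -/
theorem AdjoinRoot.finrank_ker_mulLeft {F : Type*} [Field F] {q d g a b : F[X]} (hq : q ≠ 0)
    (hdq : d ∣ q) (hdg : d ∣ g) (hd : d = a * g + b * q) :
    Module.finrank F (LinearMap.ker (LinearMap.mulLeft F (AdjoinRoot.mk q g))) = d.natDegree := by
  have hfin : FiniteDimensional F (AdjoinRoot q) := (AdjoinRoot.powerBasis hq).finite
  have hd0 : d ≠ 0 := ne_zero_of_dvd_ne_zero hq hdq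
  let φ : AdjoinRoot q →ₗ[F] AdjoinRoot d := (AdjoinRoot.algHomOfDvd F q d hdq).toLinearMap
  have hφ : ∀ h, φ (AdjoinRoot.mk q h) = AdjoinRoot.mk d h := by
    intro h
    change AdjoinRoot.algHomOfDvd F q d hdq (AdjoinRoot.mk q h) = _
    rw [← AdjoinRoot.aeval_eq, ← Polynomial.aeval_algHom_apply, AdjoinRoot.algHomOfDvd_root,
      AdjoinRoot.aeval_eq]
  have hsurj : LinearMap.range φ = ⊤ := by
    refine LinearMap.range_eq_top.2 fun y => ?_
    obtain ⟨h, rfl⟩ := AdjoinRoot.mk_surjective y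
    exact ⟨_, hφ h⟩
  have hker : LinearMap.ker φ = LinearMap.range (LinearMap.mulLeft F (AdjoinRoot.mk q g)) := by
    ext y
    obtain ⟨h, rfl⟩ := AdjoinRoot.mk_surjective y
    rw [LinearMap.mem_ker, hφ, AdjoinRoot.mk_eq_zero, LinearMap.mem_range]
    constructor
    · rintro ⟨u, rfl⟩
      refine ⟨AdjoinRoot.mk q (a * u), ?_⟩
      rw [LinearMap.mulLeft_apply, ← map_mul, AdjoinRoot.mk_eq_mk, hd]
      exact ⟨-(b * u), by ring⟩
    · rintro ⟨z, hz⟩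
      obtain ⟨u, rfl⟩ := AdjoinRoot.mk_surjective z
      rw [LinearMap.mulLeft_apply, ← map_mul, AdjoinRoot.mk_eq_mk] at hz
      have := (hdg.mul_right u).sub (hdq.trans hz)
      rwa [sub_sub_cancel] at this
  have h1 := LinearMap.finrank_range_add_finrank_ker φ
  have h2 := LinearMap.finrank_range_add_finrank_ker (LinearMap.mulLeft F (AdjoinRoot.mk q g))
  rw [hsurj, finrank_top, hker, AdjoinRoot.finrank_eq_natDegree hd0] at h1
  omega

theorem AdjoinRoot.finrank_ker_mulLeft_pow_self {F : Type*} [Field F] {p : F[X]} (hp : p ≠ 0)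
    (m k : ℕ) :
    Module.finrank F (LinearMap.ker (LinearMap.mulLeft F (AdjoinRoot.mk (p ^ m) (p ^ k)))) =
      min k m * p.natDegree := by
  rw [← natDegree_pow]
  rcases le_total k m with h | h
  · exact finrank_ker_mulLeft (a := 1) (b := 0) (pow_ne_zero _ hp)
      (pow_dvd_pow _ (min_le_right _ _)) (pow_dvd_pow _ (min_le_left _ _)) (by simp [h])
  · exact finrank_ker_mulLeft (a := 0) (b := 1) (pow_ne_zero _ hp)
      (pow_dvd_pow _ (min_le_right _ _)) (pow_dvd_pow _ (min_le_left _ _)) (by simp [h])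

theorem AdjoinRoot.finrank_ker_mulLeft_of_isCoprime {F : Type*} [Field F] {q g : F[X]}
    (hq : q ≠ 0) (h : IsCoprime g q) :
    Module.finrank F (LinearMap.ker (LinearMap.mulLeft F (AdjoinRoot.mk q g))) = 0 := by
  obtain ⟨a, b, h⟩ := h
  rw [finrank_ker_mulLeft hq (one_dvd _) (one_dvd _) h.symm, natDegree_one]

open Classical in
-- For `r = p` the dimension is `min j m * deg p`, linear in `j` except for a kink at `j = m`; for
-- `r ≠ p` it vanishes. The additive form avoids truncated subtraction.
theorem AdjoinRoot.two_mul_finrank_ker_mulLeft {F : Type*} [Field F] {p r : F[X]} (hp : p.Monic)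
    (hpi : Irreducible p) (hr : r.Monic) (hri : Irreducible r) {k m : ℕ} (hk : 1 ≤ k) (hm : 1 ≤ m) :
    2 * Module.finrank F (LinearMap.ker (LinearMap.mulLeft F (AdjoinRoot.mk (r ^ m) (p ^ k)))) =
      Module.finrank F (LinearMap.ker (LinearMap.mulLeft F (AdjoinRoot.mk (r ^ m) (p ^ (k - 1))))) +
      Module.finrank F (LinearMap.ker (LinearMap.mulLeft F (AdjoinRoot.mk (r ^ m) (p ^ (k + 1))))) +
      p.natDegree * if r ^ m = p ^ k then 1 else 0 := by
  by_cases hrp : r = p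
  · subst hrp
    have hinj : r ^ m = r ^ k ↔ m = k := by
      refine ⟨fun h => ?_, fun h => by rw [h]⟩
      have := congrArg natDegree h
      rw [natDegree_pow, natDegree_pow] at this
      exact Nat.eq_of_mul_eq_mul_right hri.natDegree_pos this
    simp only [finrank_ker_mulLeft_pow_self hr.ne_zero, hinj]
    obtain ⟨k, rfl⟩ := Nat.exists_eq_add_of_le' hk
    rcases lt_trichotomy m (k + 1) with h | h | h
    · rw [if_neg h.ne, min_eq_right (by omega), min_eq_right (by omega), min_eq_right (by omega)]
      ring
    · rw [if_pos h, min_eq_left (by omega), min_eq_left (by omega), min_eq_right (by omega), h,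
        Nat.add_sub_cancel]
      ring
    · rw [if_neg h.ne', min_eq_left (by omega), min_eq_left (by omega), min_eq_left (by omega),
        Nat.add_sub_cancel]
      ring
  · have hcop : IsCoprime p r := by
      rcases EuclideanDomain.dvd_or_coprime p r hpi with h | h
      swap
      · exact h
      · exact absurd (eq_of_monic_of_associated hp hr (hpi.associated_of_dvd hri h)).symm hrp
    have hne : r ^ m ≠ p ^ k := fun h => by
      have h2 : IsCoprime (p ^ k) (p ^ k) := by
        have := hcop.pow (m := k) (n := m)
        rwa [h] at this
      exact hpi.not_isUnit ((isUnit_pow_iff (by omega)).1 (isCoprime_self.1 h2))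
    have h0 : ∀ j, Module.finrank F
        (LinearMap.ker (LinearMap.mulLeft F (AdjoinRoot.mk (r ^ m) (p ^ j)))) = 0 := fun j =>
      finrank_ker_mulLeft_of_isCoprime (pow_ne_zero _ hr.ne_zero) hcop.pow
    simp only [h0, if_neg hne]
    simp

end Kernel

theorem Polynomial.aeval_reverse_of_inverse {F A : Type*} [Field F] [Ring A] [Algebra F A]
    {x y : A} (hxy : x * y = 1) (h : F[X]) :
    aeval x h.reverse = x ^ h.natDegree * aeval y h := by
  -- The reverse drops degree when `h(0) = 0`, so its sum is extended to `h.natDegree`.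
  rw [aeval_eq_sum_range' (Nat.lt_succ_of_le h.reverse_natDegree_le), aeval_eq_sum_range,
    Finset.mul_sum, ← Finset.sum_range_reflect]
  refine Finset.sum_congr rfl fun i hi => ?_
  have hi : i ≤ h.natDegree := Nat.lt_succ_iff.1 (Finset.mem_range.1 hi)
  have h1 : ∀ n, x ^ n * y ^ n = 1 := by
    intro n
    induction n with
    | zero => simp
    | succ n ih => rw [pow_succ, pow_succ', mul_assoc, ← mul_assoc x y, hxy, one_mul, ih]
  have hi2 : h.natDegree.succ - 1 - i = h.natDegree - i := by omega
  rw [hi2, coeff_reverse, revAt_le (Nat.sub_le _ _), Nat.sub_sub_self hi, mul_smul_comm]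
  congr 1
  conv_rhs => rw [← Nat.sub_add_cancel hi, pow_add, mul_assoc, h1, mul_one]

/-! ### Multiplicities from kernel dimensions -/

section Decomposition

variable {F V : Type*} [Field F] [AddCommGroup V] [Module F V] {T : V →ₗ[F] V} {n : ℕ}
  {q : Fin n → F[X]} {e : V ≃ₗ[F] (∀ i, AdjoinRoot (q i))}

theorem apply_aeval_of_intertwining (he : ∀ v i, e (T v) i = AdjoinRoot.root (q i) * e v i)
    (g : F[X]) (v : V) (i : Fin n) :
    e (aeval T g v) i = AdjoinRoot.mk (q i) g * e v i := by
  induction g using Polynomial.induction_on' generalizing v with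
  | add f g hf hg => simp [hf, hg, add_mul]
  | monomial k a =>
    induction k generalizing v with
    | zero =>
      rw [monomial_zero_left, aeval_C, Module.algebraMap_end_apply, map_smul, Pi.smul_apply,
        Algebra.smul_def]
      rfl
    | succ k ih =>
      have : (monomial (k + 1) a : F[X]) = monomial k a * X := by rw [monomial_mul_X]
      rw [this, map_mul, aeval_X, Module.End.mul_apply, ih, he, map_mul, AdjoinRoot.mk_X, mul_assoc]

theorem finrank_ker_aeval (hq : ∀ i, q i ≠ 0)
    (he : ∀ v i, e (T v) i = AdjoinRoot.root (q i) * e v i) (g : F[X]) :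
    Module.finrank F (LinearMap.ker (aeval T g)) = ∑ i, Module.finrank F
      (LinearMap.ker (LinearMap.mulLeft F (AdjoinRoot.mk (q i) g))) := by
  have hfin : ∀ i, FiniteDimensional F (AdjoinRoot (q i)) := fun i =>
    (AdjoinRoot.powerBasis (hq i)).finite
  rw [← Module.finrank_pi_fintype]
  let φ : LinearMap.ker (aeval T g) →ₗ[F]
      ∀ i, LinearMap.ker (LinearMap.mulLeft F (AdjoinRoot.mk (q i) g)) :=
    LinearMap.pi fun i => LinearMap.codRestrict _
      (LinearMap.proj i ∘ₗ e.toLinearMap ∘ₗ Submodule.subtype _) fun v => by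
        have hv : aeval T g v.1 = 0 := v.2
        rw [LinearMap.mem_ker, LinearMap.mulLeft_apply]
        change _ * e v.1 i = 0
        rw [← apply_aeval_of_intertwining he, hv, map_zero, Pi.zero_apply]
  have hφ : ∀ v i, (φ v i : AdjoinRoot (q i)) = e v.1 i := fun v i => rfl
  refine (LinearEquiv.ofBijective φ ⟨fun v w h => ?_, fun y => ?_⟩).finrank_eq
  · refine Subtype.ext (e.injective (funext fun i => ?_))
    rw [← hφ, ← hφ, h]
  · refine ⟨⟨e.symm fun i => (y i : AdjoinRoot (q i)), ?_⟩, funext fun i => Subtype.ext ?_⟩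
    · refine e.injective (funext fun i => ?_)
      rw [apply_aeval_of_intertwining he, LinearEquiv.apply_symm_apply, map_zero]
      exact (y i).2
    · rw [hφ, LinearEquiv.apply_symm_apply]

open Classical in
theorem two_mul_finrank_ker_aeval
    (hq : ∀ i, ∃ (p : F[X]) (k : ℕ), p.Monic ∧ Irreducible p ∧ 1 ≤ k ∧ q i = p ^ k)
    (he : ∀ v i, e (T v) i = AdjoinRoot.root (q i) * e v i) {p : F[X]} (hp : p.Monic)
    (hpi : Irreducible p) {k : ℕ} (hk : 1 ≤ k) :
    2 * Module.finrank F (LinearMap.ker (aeval T (p ^ k))) =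
      Module.finrank F (LinearMap.ker (aeval T (p ^ (k - 1)))) +
      Module.finrank F (LinearMap.ker (aeval T (p ^ (k + 1)))) +
      p.natDegree * ((Finset.univ : Finset (Fin n)).val.map q).count (p ^ k) := by
  have hq0 : ∀ i, q i ≠ 0 := fun i => by
    obtain ⟨r, m, hr, -, -, h⟩ := hq i
    rw [h]
    exact pow_ne_zero _ hr.ne_zero
  have hcount : ((Finset.univ : Finset (Fin n)).val.map q).count (p ^ k) =
      ∑ i, if q i = p ^ k then 1 else 0 := by
    rw [Multiset.count_map, ← Finset.card_filter]
    simp only [eq_comm]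
    rfl
  rw [hcount]
  simp only [finrank_ker_aeval hq0 he, Finset.mul_sum, ← Finset.sum_add_distrib]
  refine Finset.sum_congr rfl fun i _ => ?_
  obtain ⟨r, m, hr, hri, hm, h⟩ := hq i
  rw [h]
  exact AdjoinRoot.two_mul_finrank_ker_mulLeft hp hpi hr hri hk hm

/-- Surjectivity of `T` puts `1` in the image of multiplication by `x` on each summand, which is
impossible if `x` divides `q i`. -/
theorem coeff_zero_ne_zero_of_intertwining (hT : Function.Surjective T)
    (he : ∀ v i, e (T v) i = AdjoinRoot.root (q i) * e v i) (i : Fin n) : (q i).coeff 0 ≠ 0 := by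
  intro h0
  obtain ⟨v, hv⟩ := hT (e.symm 1)
  have h1 := he v i
  rw [hv, LinearEquiv.apply_symm_apply, Pi.one_apply] at h1
  obtain ⟨g, hg⟩ := AdjoinRoot.mk_surjective (e v i)
  rw [← hg, ← AdjoinRoot.mk_X, ← map_mul, ← map_one (AdjoinRoot.mk (q i)),
    AdjoinRoot.mk_eq_mk] at h1
  have h2 := (X_dvd_iff.2 h0).trans h1
  rw [X_dvd_iff] at h2
  simp at h2

end Decomposition

/-! ### Necessity: adjoints under an invariant form -/

section Adjoint

variable {F V : Type*} [Field F] [AddCommGroup V] [Module F V] {c : F ≃+* F}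
  {T : V ≃ₗ[F] V} {σ : V →ₗ[F] V →ₛₗ[(c : F →+* F)] F}

theorem IsInvariantForm.apply_aeval (hc : ∀ a, c (c a) = a)
    (h : IsInvariantForm (T : V →ₗ[F] V) σ) (g : F[X]) (v w : V) :
    σ (aeval (T : V →ₗ[F] V) g v) w =
      σ v (aeval (T.symm : V →ₗ[F] V) (g.map (c : F →+* F)) w) := by
  induction g using Polynomial.induction_on' generalizing v with
  | add f g hf hg => simp [hf, hg]
  | monomial k a =>
    rw [map_monomial]
    induction k generalizing v with
    | zero =>
      rw [monomial_zero_left, monomial_zero_left, aeval_C, aeval_C, Module.algebraMap_end_apply,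
        Module.algebraMap_end_apply, map_smul, LinearMap.smul_apply, LinearMap.map_smulₛₗ]
      simp [hc]
    | succ k ih =>
      have h1 : (monomial (k + 1) a : F[X]) = monomial k a * X := by rw [monomial_mul_X]
      have h2 : (monomial (k + 1) ((c : F →+* F) a) : F[X]) = X * monomial k ((c : F →+* F) a) := by
        rw [X_mul_monomial]
      rw [h1, h2, map_mul, map_mul, aeval_X, aeval_X, Module.End.mul_apply, Module.End.mul_apply,
        ih, ← h v]
      simp

variable [FiniteDimensional F V]

/-- The map `w ↦ σ(·, w)` is injective from `ker g*(T)` into the annihilator of the range of `g(T)`,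
whose dimension is that of `ker g(T)`. -/
theorem finrank_ker_aeval_dualPoly_le (hc : ∀ a, c (c a) = a)
    (h : IsInvariantForm (T : V →ₗ[F] V) σ) (hσ : σ.Nondegenerate) {g : F[X]}
    (h0 : g.coeff 0 ≠ 0) :
    Module.finrank F (LinearMap.ker (aeval (T : V →ₗ[F] V) (dualPoly c g))) ≤
      Module.finrank F (LinearMap.ker (aeval (T : V →ₗ[F] V) g)) := by
  have hTT : (T : V →ₗ[F] V) * (T.symm : V →ₗ[F] V) = 1 := by ext; simp
  have key : ∀ w ∈ LinearMap.ker (aeval (T : V →ₗ[F] V) (dualPoly c g)),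
      aeval (T.symm : V →ₗ[F] V) (g.map (c : F →+* F)) w = 0 := by
    intro w hw
    rw [LinearMap.mem_ker, dualPoly, map_mul, aeval_C, Module.End.mul_apply,
      Module.algebraMap_end_apply, aeval_reverse_of_inverse hTT, Module.End.mul_apply] at hw
    have h1 := (smul_eq_zero.1 hw).resolve_left (inv_ne_zero ((map_ne_zero c).2 h0))
    -- The power of `T` produced by reversal is cancelled by injectivity.
    generalize (g.map (c : F →+* F)).natDegree = d at h1
    induction d with
    | zero => simpa using h1
    | succ d ih =>
      rw [pow_succ', Module.End.mul_apply] at h1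
      exact ih (T.map_eq_zero_iff.1 h1)
  let j : LinearMap.ker (aeval (T : V →ₗ[F] V) (dualPoly c g)) →+
      (LinearMap.range (aeval (T : V →ₗ[F] V) g)).dualAnnihilator :=
    { toFun := fun w => ⟨σ.flip w.1, by
        rw [Submodule.mem_dualAnnihilator]
        rintro _ ⟨v, rfl⟩
        rw [LinearMap.flip_apply, h.apply_aeval hc, key _ w.2, map_zero]⟩
      map_zero' := by ext; simp
      map_add' := fun _ _ => by ext; simp }
  have hj : Function.Injective j := by
    rw [injective_iff_map_eq_zero]
    intro w hw
    refine Subtype.ext (hσ.2 _ fun v => ?_)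
    exact LinearMap.congr_fun (congrArg Subtype.val hw) v
  -- `j` is only `c`-semilinear, so ranks are compared through the semilinear version.
  have hrank := lift_rank_le_of_injective_injectiveₛ (fun a : F => c a) j c.injective hj
    (fun a w => by ext v; simp [j, hc])
  rw [← Module.finrank_eq_rank, ← Module.finrank_eq_rank, Cardinal.lift_natCast,
    Cardinal.lift_natCast, Nat.cast_le] at hrank
  have h1 := Subspace.finrank_add_finrank_dualAnnihilator_eq
    (LinearMap.range (aeval (T : V →ₗ[F] V) g))
  have h2 := LinearMap.finrank_range_add_finrank_ker (aeval (T : V →ₗ[F] V) g)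
  omega

theorem finrank_ker_aeval_dualPoly (hc : ∀ a, c (c a) = a)
    (h : IsInvariantForm (T : V →ₗ[F] V) σ) (hσ : σ.Nondegenerate) {g : F[X]} (hg : g.Monic)
    (h0 : g.coeff 0 ≠ 0) :
    Module.finrank F (LinearMap.ker (aeval (T : V →ₗ[F] V) (dualPoly c g))) =
      Module.finrank F (LinearMap.ker (aeval (T : V →ₗ[F] V) g)) := by
  refine le_antisymm (finrank_ker_aeval_dualPoly_le hc h hσ h0) ?_
  have := finrank_ker_aeval_dualPoly_le hc h hσ (coeff_zero_dualPoly_ne_zero (c := c) hg h0)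
  rwa [dualPoly_dualPoly hc hg h0] at this

open Classical in
theorem count_dualPoly_of_isInvariantForm (hc : ∀ a, c (c a) = a)
    (h : IsInvariantForm (T : V →ₗ[F] V) σ) (hσ : σ.Nondegenerate) {S : Multiset F[X]}
    (hS : IsElementaryDivisors (T : V →ₗ[F] V) S) {f : F[X]} (hf : f ∈ S) :
    S.count (dualPoly c f) = S.count f := by
  obtain ⟨n, q, rfl, hq, e, he⟩ := hS
  obtain ⟨i, -, rfl⟩ := Multiset.mem_map.1 hf
  obtain ⟨p, k, hp, hpi, hk, hqi⟩ := hq i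
  have h0 : p.coeff 0 ≠ 0 := fun h0 => coeff_zero_ne_zero_of_intertwining T.surjective he i (by
    rw [hqi, coeff_zero_eq_eval_zero, eval_pow, ← coeff_zero_eq_eval_zero, h0,
      zero_pow (by omega)])
  have hN : ∀ j, Module.finrank F (LinearMap.ker (aeval (T : V →ₗ[F] V) (dualPoly c p ^ j))) =
      Module.finrank F (LinearMap.ker (aeval (T : V →ₗ[F] V) (p ^ j))) := fun j => by
    rw [← dualPoly_pow]
    refine finrank_ker_aeval_dualPoly hc h hσ (hp.pow j) ?_
    rw [coeff_zero_eq_eval_zero, eval_pow, ← coeff_zero_eq_eval_zero]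
    exact pow_ne_zero _ h0
  have h1 := two_mul_finrank_ker_aeval hq he hp hpi hk
  have h2 := two_mul_finrank_ker_aeval hq he (monic_dualPoly (c := c) h0)
    (irreducible_dualPoly hc hp h0 hpi) hk
  rw [hN, hN, hN, h1, natDegree_dualPoly h0] at h2
  rw [hqi, dualPoly_pow]
  exact (Nat.eq_of_mul_eq_mul_left hpi.natDegree_pos (Nat.add_left_cancel h2)).symm

end Adjoint

/-! ### Matching summands and filling a symmetric matrix -/

section Combinatorics

/-- Number each fibre of `q` and send `i` to the element with the same number in the fibre over `D
(q i)`. -/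
theorem exists_involutive_of_card_fiber_eq {ι α : Type*} [Fintype ι] [DecidableEq α] (q : ι → α)
    (D : α → α) (hD : ∀ i, D (D (q i)) = q i)
    (hcard : ∀ i, Fintype.card {j // q j = D (q i)} = Fintype.card {j // q j = q i}) :
    ∃ π : ι → ι, Function.Involutive π ∧ ∀ i, q (π i) = D (q i) := by
  let E : ∀ a : α, {j // q j = a} ≃ Fin (Fintype.card {j // q j = a}) := fun a =>
    Fintype.equivFin _
  let m : ι → ℕ := fun i => (E (q i) ⟨i, rfl⟩).val
  have hm : ∀ a i (h : q i = a), m i = (E a ⟨i, h⟩).val := by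
    rintro _ i rfl; rfl
  have hinj : ∀ i j, q i = q j → m i = m j → i = j := by
    intro i j h h2
    rw [hm (q j) i h, hm (q j) j rfl] at h2
    exact congrArg Subtype.val ((E (q j)).injective (Fin.ext h2))
  have hex : ∀ i, ∃ j, q j = D (q i) ∧ m j = m i := by
    intro i
    have hlt : m i < Fintype.card {j // q j = D (q i)} := by
      rw [hcard]
      exact (E (q i) ⟨i, rfl⟩).isLt
    refine ⟨((E (D (q i))).symm ⟨m i, hlt⟩).1, ((E (D (q i))).symm ⟨m i, hlt⟩).2, ?_⟩
    rw [hm _ _ ((E (D (q i))).symm ⟨m i, hlt⟩).2]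
    simp
  choose π hπ hπm using hex
  refine ⟨π, fun i => hinj _ _ ?_ ?_, hπ⟩
  · rw [hπ, hπ, hD]
  · rw [hπm, hπm]

/-- Entries above the diagonal are free and those below are their reflections; only diagonal entries
must be fixed by `swap`. -/
theorem exists_symmetric_family {ι : Type*} [LinearOrder ι] {X : ι → ι → Type*}
    (swap : ∀ i j, X i j → X j i) (hswap : ∀ i j x, swap j i (swap i j x) = x)
    (P : ∀ i j, X i j → Prop) (hP : ∀ i j x, P i j x → P j i (swap i j x))
    (hex : ∀ i j, i < j → ∃ x, P i j x) (hdiag : ∀ i, ∃ x, P i i x ∧ swap i i x = x) :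
    ∃ B : ∀ i j, X i j, (∀ i j, P i j (B i j)) ∧ ∀ i j, swap i j (B i j) = B j i := by
  choose D hD hDs using hdiag
  choose A hA using hex
  let B : ∀ i j, X i j := fun i j =>
    if h : i < j then A i j h else if h' : j < i then swap j i (A j i h')
      else (le_antisymm (not_lt.1 h') (not_lt.1 h) : i = j) ▸ D i
  have h1 : ∀ i j (h : i < j), B i j = A i j h := fun i j h => dif_pos h
  have h2 : ∀ i j (h : j < i), B i j = swap j i (A j i h) := fun i j h => by
    simp only [B, dif_neg h.asymm, dif_pos h]
  have h3 : ∀ i, B i i = D i := fun i => by simp [B]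
  refine ⟨B, fun i j => ?_, fun i j => ?_⟩ <;> rcases lt_trichotomy i j with h | rfl | h
  · rw [h1 i j h]; exact hA i j h
  · rw [h3]; exact hD i
  · rw [h2 i j h]; exact hP _ _ _ (hA j i h)
  · rw [h1 i j h, h2 j i h]
  · rw [h3, hDs]
  · rw [h2 i j h, h1 j i h, hswap]

end Combinatorics

/-! ### The semilinear homomorphism inverting `x` -/

section Conjugation

variable {F : Type*} [Field F] {c : F ≃+* F}

theorem AdjoinRoot.isUnit_root {f : F[X]} (h0 : f.coeff 0 ≠ 0) : IsUnit (AdjoinRoot.root f) := by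
  refine IsUnit.of_mul_eq_one (AdjoinRoot.mk f (-(C (f.coeff 0)⁻¹ * f.divX))) ?_
  rw [← AdjoinRoot.mk_X, ← map_mul, ← map_one (AdjoinRoot.mk f), AdjoinRoot.mk_eq_mk]
  refine ⟨-C (f.coeff 0)⁻¹, ?_⟩
  have h1 : C (f.coeff 0) * C (f.coeff 0)⁻¹ = (1 : F[X]) := by
    rw [← C_mul, mul_inv_cancel₀ h0, C_1]
  linear_combination h1 - C (f.coeff 0)⁻¹ * f.divX_mul_X_add

/-- A ring homomorphism between the quotients by `g` and `f` that extends `c` and inverts `x`. -/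
def IsConjugation (c : F ≃+* F) {f g : F[X]} (J : AdjoinRoot g →+* AdjoinRoot f) : Prop :=
  J (AdjoinRoot.root g) * AdjoinRoot.root f = 1 ∧
    ∀ a, J (AdjoinRoot.of g a) = AdjoinRoot.of f (c a)

theorem exists_isConjugation (hc : ∀ a, c (c a) = a) {f : F[X]} (h0 : f.coeff 0 ≠ 0) :
    ∃ J : AdjoinRoot (dualPoly c f) →+* AdjoinRoot f, IsConjugation c J := by
  let : Invertible (AdjoinRoot.root f) := (AdjoinRoot.isUnit_root h0).invertible
  have h : eval₂ ((AdjoinRoot.of f).comp (c : F →+* F)) (⅟(AdjoinRoot.root f)) (dualPoly c f) =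
      0 := by
    -- Reversal trades evaluation at the inverse root for evaluation at the root, and the two
    -- applications of `c` cancel.
    rw [dualPoly, eval₂_mul, (eval₂_reverse_eq_zero_iff _ _ _).2, mul_zero]
    have hcc : ((AdjoinRoot.of f).comp (c : F →+* F)).comp (c : F →+* F) = AdjoinRoot.of f :=
      RingHom.ext fun a => congrArg (AdjoinRoot.of f) (hc a)
    rw [eval₂_map, hcc, AdjoinRoot.eval₂_root]
  refine ⟨AdjoinRoot.lift _ _ h, ?_, fun a => ?_⟩
  · rw [AdjoinRoot.lift_root, invOf_mul_self]
  · rw [AdjoinRoot.lift_of]; rfl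

namespace IsConjugation

variable {f g : F[X]} {J : AdjoinRoot g →+* AdjoinRoot f} {K : AdjoinRoot f →+* AdjoinRoot g}

theorem map_smul (hJ : IsConjugation c J) (a : F) (x : AdjoinRoot g) : J (a • x) = c a • J x := by
  rw [Algebra.smul_def, map_mul, Algebra.smul_def, AdjoinRoot.algebraMap_eq,
    AdjoinRoot.algebraMap_eq, hJ.2]

theorem apply_apply (hc : ∀ a, c (c a) = a) (hJ : IsConjugation c J) (hK : IsConjugation c K)
    (x : AdjoinRoot g) : K (J x) = x := by
  have : K.comp J = RingHom.id _ := by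
    refine AdjoinRoot.ringHom_ext ?_ ?_
    · ext a
      simp [hJ.2, hK.2, hc]
    · have h := congrArg K hJ.1
      rw [map_mul, map_one] at h
      exact left_inv_eq_right_inv h hK.1
  exact RingHom.congr_fun this x

end IsConjugation

end Conjugation

/-! ### Invariant pairings of cyclic modules -/

section Pairing

variable {F : Type*} [Field F] {c : F ≃+* F}

/-- A pairing of the quotients by `f` and `g`, linear in the first and `c`-semilinear in the second
variable, that is invariant under simultaneous multiplication by `x`. -/
structure IsInvariantPairing (c : F ≃+* F) {f g : F[X]}
    (B : AdjoinRoot f → AdjoinRoot g → F) : Prop where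
  add_left : ∀ x y z, B (x + y) z = B x z + B y z
  smul_left : ∀ (a : F) x z, B (a • x) z = a * B x z
  add_right : ∀ x y z, B x (y + z) = B x y + B x z
  smul_right : ∀ (a : F) x z, B x (a • z) = c a * B x z
  root_mul : ∀ x y, B (AdjoinRoot.root f * x) (AdjoinRoot.root g * y) = B x y

/-- Only zero is orthogonal to everything, on both sides. -/
def IsSeparatingPairing {f g : F[X]} (B : AdjoinRoot f → AdjoinRoot g → F) : Prop :=
  (∀ x, (∀ y, B x y = 0) → x = 0) ∧ ∀ y, (∀ x, B x y = 0) → y = 0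

/-- The pairing obtained by exchanging the variables and applying `c`. -/
def conjSwap (c : F ≃+* F) {f g : F[X]} (B : AdjoinRoot f → AdjoinRoot g → F) :
    AdjoinRoot g → AdjoinRoot f → F :=
  fun y x => c (B x y)

theorem conjSwap_conjSwap (hc : ∀ a, c (c a) = a) {f g : F[X]}
    (B : AdjoinRoot f → AdjoinRoot g → F) : conjSwap c (conjSwap c B) = B := by
  funext x y
  exact hc _

theorem IsInvariantPairing.conjSwap (hc : ∀ a, c (c a) = a) {f g : F[X]}
    {B : AdjoinRoot f → AdjoinRoot g → F} (hB : IsInvariantPairing c B) :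
    IsInvariantPairing c (conjSwap c B) where
  add_left x y z := by simp [_root_.conjSwap, hB.add_right]
  smul_left a x z := by simp [_root_.conjSwap, hB.smul_right, hc]
  add_right x y z := by simp [_root_.conjSwap, hB.add_left]
  smul_right a x z := by simp [_root_.conjSwap, hB.smul_left]
  root_mul x y := by simp [_root_.conjSwap, hB.root_mul]

theorem IsSeparatingPairing.conjSwap {f g : F[X]}
    {B : AdjoinRoot f → AdjoinRoot g → F} (hB : IsSeparatingPairing B) :
    IsSeparatingPairing (conjSwap c B) :=
  ⟨fun y h => hB.2 y fun x => (map_eq_zero c).1 (h x),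
    fun x h => hB.1 x fun y => (map_eq_zero c).1 (h y)⟩

theorem isInvariantPairing_mul_conj {f g : F[X]} {J : AdjoinRoot g →+* AdjoinRoot f}
    (hJ : IsConjugation c J) (l : AdjoinRoot f →ₗ[F] F) :
    IsInvariantPairing c fun x y => l (x * J y) where
  add_left x y z := by simp [add_mul]
  smul_left a x z := by simp
  add_right x y z := by simp [mul_add]
  smul_right a x z := by simp [hJ.map_smul]
  root_mul x y := by
    congr 1
    rw [map_mul]
    linear_combination (x * J y) * hJ.1

/-- A gcd of a representative of `x` with `p^(k+1)` is associated to some `p^j` with `j ≤ k`; Bézout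
then gives `y`. -/
theorem AdjoinRoot.exists_mul_eq_mk_pow {p : F[X]} (hp : Irreducible p) {k : ℕ} {f : F[X]}
    (hf : f = p ^ (k + 1)) {x : AdjoinRoot f} (hx : x ≠ 0) :
    ∃ y, y * x = AdjoinRoot.mk f (p ^ k) := by
  classical
  subst hf
  obtain ⟨h, rfl⟩ := AdjoinRoot.mk_surjective x
  rw [Ne, AdjoinRoot.mk_eq_zero] at hx
  have hdvd : EuclideanDomain.gcd h (p ^ (k + 1)) ∣ p ^ k := by
    obtain ⟨j, hj, hjg⟩ := (dvd_prime_pow hp.prime _).1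
      (EuclideanDomain.gcd_dvd_right h (p ^ (k + 1)))
    have hjk : j ≠ k + 1 := by
      rintro rfl
      exact hx (hjg.symm.dvd.trans (EuclideanDomain.gcd_dvd_left _ _))
    exact hjg.dvd.trans (pow_dvd_pow _ (by omega))
  obtain ⟨u, hu⟩ := hdvd
  rw [EuclideanDomain.gcd_eq_gcd_ab] at hu
  refine ⟨AdjoinRoot.mk _ (EuclideanDomain.gcdA h (p ^ (k + 1)) * u), ?_⟩
  rw [← map_mul, AdjoinRoot.mk_eq_mk, hu]
  exact ⟨-(EuclideanDomain.gcdB h (p ^ (k + 1)) * u), by ring⟩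

theorem AdjoinRoot.mk_pow_ne_zero {p : F[X]} (hp : Irreducible p) (k : ℕ) {f : F[X]}
    (hf : f = p ^ (k + 1)) : AdjoinRoot.mk f (p ^ k) ≠ 0 := by
  subst hf
  rw [Ne, AdjoinRoot.mk_eq_zero, pow_dvd_pow_iff hp.ne_zero hp.not_isUnit]
  omega

theorem isSeparatingPairing_mul_conj (hc : ∀ a, c (c a) = a) {f g : F[X]}
    {J : AdjoinRoot g →+* AdjoinRoot f} {K : AdjoinRoot f →+* AdjoinRoot g}
    (hJ : IsConjugation c J) (hK : IsConjugation c K) {p : F[X]} (hp : Irreducible p) {k : ℕ}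
    (hf : f = p ^ (k + 1)) {l : AdjoinRoot f →ₗ[F] F} (hl : l (AdjoinRoot.mk f (p ^ k)) ≠ 0) :
    IsSeparatingPairing fun x y => l (x * J y) := by
  refine ⟨fun x hx => ?_, fun y hy => ?_⟩
  · by_contra hne
    obtain ⟨z, hz⟩ := AdjoinRoot.exists_mul_eq_mk_pow hp hf hne
    have : l (x * J (K z)) = 0 := hx (K z)
    rw [hK.apply_apply hc hJ, mul_comm, hz] at this
    exact hl this
  · by_contra hne
    have hne : J y ≠ 0 := fun h => hne (by rw [← hJ.apply_apply hc hK y, h, map_zero])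
    obtain ⟨z, hz⟩ := AdjoinRoot.exists_mul_eq_mk_pow hp hf hne
    exact hl (hz ▸ hy z)

theorem exists_separating_pairing (hc : ∀ a, c (c a) = a) {f g p : F[X]} {k : ℕ} (hp : p.Monic)
    (hpi : Irreducible p) (hk : 1 ≤ k) (hf : f = p ^ k) (h0 : f.coeff 0 ≠ 0)
    (hg : g = dualPoly c f) :
    ∃ B : AdjoinRoot f → AdjoinRoot g → F, IsInvariantPairing c B ∧ IsSeparatingPairing B := by
  obtain ⟨k, rfl⟩ := Nat.exists_eq_add_of_le' hk
  have hfm : f.Monic := hf ▸ hp.pow _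
  obtain ⟨J, hJ⟩ := exists_isConjugation hc h0
  have hK := exists_isConjugation hc (coeff_zero_dualPoly_ne_zero (c := c) hfm h0)
  rw [dualPoly_dualPoly hc hfm h0] at hK
  rw [← hg] at hK J
  obtain ⟨K, hK⟩ := hK
  subst hg
  obtain ⟨l, hl⟩ := not_forall.1 (mt (Module.forall_dual_apply_eq_zero_iff F _).1
    (AdjoinRoot.mk_pow_ne_zero hpi k hf))
  exact ⟨_, isInvariantPairing_mul_conj hJ l, isSeparatingPairing_mul_conj hc hJ hK hpi hf hl⟩

/-- The pairing is hermitian once `c (l z) = l (J z)`, which the trace-like functional `L r`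
satisfies for every `r`. -/
theorem exists_hermitian_separating_pairing (hc : ∀ a, c (c a) = a)
    (hc_ne : c ≠ RingEquiv.refl F) {f p : F[X]} {k : ℕ} (hpi : Irreducible p) (hk : 1 ≤ k)
    (hf : f = p ^ k) (h0 : f.coeff 0 ≠ 0) (hff : dualPoly c f = f) :
    ∃ B : AdjoinRoot f → AdjoinRoot f → F,
      IsInvariantPairing c B ∧ IsSeparatingPairing B ∧ conjSwap c B = B := by
  obtain ⟨k, rfl⟩ := Nat.exists_eq_add_of_le' hk
  have hJ := exists_isConjugation hc h0
  rw [hff] at hJ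
  obtain ⟨J, hJ⟩ := hJ
  obtain ⟨l, hl⟩ := not_forall.1 (mt (Module.forall_dual_apply_eq_zero_iff F _).1
    (AdjoinRoot.mk_pow_ne_zero hpi k hf))
  let L : F → AdjoinRoot f →ₗ[F] F := fun r =>
    { toFun := fun x => r * l x + c (r * l (J x))
      map_add' := fun x y => by simp only [map_add, map_mul]; ring
      map_smul' := fun a x => by
        simp only [hJ.map_smul, map_smul, smul_eq_mul, map_mul, hc, RingHom.id_apply]; ring }
  have hL : ∀ r x, L r x = r * l x + c (r * l (J x)) := fun _ _ => rfl
  -- If `L 1` and `L r` both vanish at `p^k`, eliminating `l (J (p^k))` leaves `(r - c r) * l (p^k)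
  -- = 0`, so `c r = r`.
  have hex : ∃ r, L r (AdjoinRoot.mk f (p ^ k)) ≠ 0 := by
    by_contra! h
    refine hc_ne (RingEquiv.ext fun r => ?_)
    have h1 := h 1
    have h2 := h r
    rw [hL, map_mul] at h1 h2
    rw [map_one] at h1
    have h3 : (r - c r) * l (AdjoinRoot.mk f (p ^ k)) = 0 := by linear_combination h2 - c r * h1
    exact (sub_eq_zero.1 ((mul_eq_zero.1 h3).resolve_right hl)).symm
  obtain ⟨r, hr⟩ := hex
  refine ⟨_, isInvariantPairing_mul_conj hJ (L r),
    isSeparatingPairing_mul_conj hc hJ hJ hpi hf hr, ?_⟩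
  funext x y
  have hLJ : ∀ z, c (L r z) = L r (J z) := fun z => by
    rw [hL, hL, hJ.apply_apply hc hJ, map_add, hc]; ring
  rw [conjSwap, hLJ, map_mul, hJ.apply_apply hc hJ, mul_comm]

theorem isInvariantPairing_zero {f g : F[X]} :
    IsInvariantPairing c fun (_ : AdjoinRoot f) (_ : AdjoinRoot g) => (0 : F) := by
  constructor <;> simp

end Pairing

/-! ### Sufficiency: assembling the form -/

section Existence

variable {F V : Type*} [Field F] [AddCommGroup V] [Module F V] {c : F ≃+* F}

theorem exists_hermitian_invariant_form {T : V →ₗ[F] V} {n : ℕ}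
    {q : Fin n → F[X]} {e : V ≃ₗ[F] (∀ i, AdjoinRoot (q i))}
    (he : ∀ v i, e (T v) i = AdjoinRoot.root (q i) * e v i)
    {π : Fin n → Fin n} (hπ : Function.Injective π)
    {B : ∀ i j, AdjoinRoot (q i) → AdjoinRoot (q j) → F}
    (hB : ∀ i j, IsInvariantPairing c (B i j)) (hsep : ∀ i, IsSeparatingPairing (B i (π i)))
    (hzero : ∀ i j, j ≠ π i → ∀ x y, B i j x y = 0) (hswap : ∀ i j, conjSwap c (B i j) = B j i) :
    ∃ σ : V →ₗ[F] V →ₛₗ[(c : F →+* F)] F,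
      IsHermitianForm c σ ∧ IsInvariantForm T σ ∧ σ.Nondegenerate := by
  let σ : V →ₗ[F] V →ₛₗ[(c : F →+* F)] F :=
    LinearMap.mk₂'ₛₗ (RingHom.id F) (c : F →+* F) (fun v w => ∑ i, ∑ j, B i j (e v i) (e w j))
      (fun v v' w => by simp [(hB _ _).add_left, Finset.sum_add_distrib])
      (fun a v w => by simp [(hB _ _).smul_left, Finset.mul_sum])
      (fun v w w' => by simp [(hB _ _).add_right, Finset.sum_add_distrib])
      (fun a v w => by simp [(hB _ _).smul_right, Finset.mul_sum])
  have hσ : ∀ v w, σ v w = ∑ i, ∑ j, B i j (e v i) (e w j) := fun _ _ => rfl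
  have hherm : IsHermitianForm c σ := by
    intro v w
    rw [hσ, hσ, Finset.sum_comm, map_sum]
    refine Finset.sum_congr rfl fun j _ => ?_
    rw [map_sum]
    refine Finset.sum_congr rfl fun i _ => ?_
    rw [← hswap]; rfl
  have hB0 : ∀ i j x, B i j x 0 = 0 := fun i j x => by
    simpa using (hB i j).smul_right 0 x 0
  have hleft : σ.SeparatingLeft := by
    intro v hv
    refine e.injective (funext fun i => ?_)
    rw [map_zero, Pi.zero_apply]
    refine (hsep i).1 _ fun y => ?_
    -- Testing against vectors supported on summand `π i` isolates block `(i, π i)`, since `π` is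
    -- injective.
    have h := hv (e.symm (Pi.single (π i) y))
    rw [hσ, LinearEquiv.apply_symm_apply, Finset.sum_eq_single i, Finset.sum_eq_single (π i),
      Pi.single_eq_same] at h
    · exact h
    · intro j _ hj
      exact hzero _ _ hj _ _
    · simp
    · intro i' _ hi'
      refine Finset.sum_eq_zero fun j _ => ?_
      by_cases hj : j = π i
      · exact hzero _ _ (fun h => hi' (hπ (h.symm.trans hj))) _ _
      · rw [Pi.single_eq_of_ne hj, hB0]
    · simp
  refine ⟨σ, hherm, fun v w => ?_, hleft, fun w hw => hleft w fun v => ?_⟩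
  · simp only [hσ, he, (hB _ _).root_mul]
  · rw [hherm, hw, map_zero]

open Classical in
theorem exists_hermitian_invariant_form_of_count (hc : ∀ a, c (c a) = a)
    (hc_ne : c ≠ RingEquiv.refl F) {T : V →ₗ[F] V} (hT : Function.Surjective T)
    {S : Multiset F[X]} (hS : IsElementaryDivisors T S)
    (hcount : ∀ f ∈ S, S.count (dualPoly c f) = S.count f) :
    ∃ σ : V →ₗ[F] V →ₛₗ[(c : F →+* F)] F,
      IsHermitianForm c σ ∧ IsInvariantForm T σ ∧ σ.Nondegenerate := by
  obtain ⟨n, q, rfl, hq, e, he⟩ := hS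
  have h0 := coeff_zero_ne_zero_of_intertwining hT he
  have hm : ∀ i, (q i).Monic := fun i => by
    obtain ⟨p, k, hp, -, -, h⟩ := hq i
    exact h ▸ hp.pow k
  have hdd : ∀ i, dualPoly c (dualPoly c (q i)) = q i := fun i => dualPoly_dualPoly hc (hm i) (h0 i)
  have hcard : ∀ f, ((Finset.univ : Finset (Fin n)).val.map q).count f =
      Fintype.card {j // q j = f} := fun f => by
    rw [Multiset.count_map, ← Finset.filter_val, Finset.card_val, Fintype.card_subtype]
    simp only [eq_comm]
  obtain ⟨π, hπ, hqπ⟩ := exists_involutive_of_card_fiber_eq q (dualPoly c) hdd fun i => by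
    rw [← hcard, ← hcard]
    exact hcount _ (Multiset.mem_map_of_mem q (Finset.mem_univ i))
  obtain ⟨B, hB, hswap⟩ := exists_symmetric_family
    (X := fun i j => AdjoinRoot (q i) → AdjoinRoot (q j) → F)
    (fun i j => conjSwap c) (fun i j => conjSwap_conjSwap hc)
    (fun i j B => IsInvariantPairing c B ∧ (j = π i → IsSeparatingPairing B) ∧
      (j ≠ π i → ∀ x y, B x y = 0))
    (fun i j B hB => ⟨hB.1.conjSwap hc, fun h => (hB.2.1 (by rw [h, hπ])).conjSwap,
      fun h y x => by
        rw [conjSwap, hB.2.2 (fun h' => h (by rw [h', hπ])), map_zero]⟩)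
    (fun i j _ => by
      by_cases h : j = π i
      · obtain ⟨p, k, hp, hpi, hk, hpk⟩ := hq i
        obtain ⟨B, hB, hs⟩ := exists_separating_pairing hc hp hpi hk hpk (h0 i)
          (g := q j) (by rw [h, hqπ])
        exact ⟨B, hB, fun _ => hs, fun h' => absurd h h'⟩
      · exact ⟨_, isInvariantPairing_zero, fun h' => absurd h' h, fun _ _ _ => rfl⟩)
    (fun i => by
      -- Only fixed points of `π` need a hermitian pairing; otherwise the diagonal block is zero,
      -- even if `q i` is self-dual.
      by_cases h : i = π i
      · obtain ⟨p, k, hp, hpi, hk, hpk⟩ := hq i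
        obtain ⟨B, hB, hs, hB2⟩ := exists_hermitian_separating_pairing hc hc_ne hpi hk hpk (h0 i)
          (by rw [← hqπ, ← h])
        exact ⟨B, ⟨hB, fun _ => hs, fun h' => absurd h h'⟩, hB2⟩
      · exact ⟨fun _ _ => 0, ⟨isInvariantPairing_zero, fun h' => absurd h' h, fun _ _ _ => rfl⟩,
          by funext x y; exact map_zero c⟩)
  exact exists_hermitian_invariant_form he hπ.injective (fun i j => (hB i j).1)
    (fun i => (hB i _).2.1 rfl) (fun i j => (hB i j).2.2) hswap

end Existence

theorem theorem2p1 {F V : Type*} [Field F] [AddCommGroup V] [Module F V] [FiniteDimensional F V]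
    (c : F ≃+* F) (hc : ∀ a, c (c a) = a) (hc_ne : c ≠ RingEquiv.refl F) (T : V ≃ₗ[F] V) :
    (∃ σ : V →ₗ[F] V →ₛₗ[(c : F →+* F)] F,
        IsHermitianForm c σ ∧ IsInvariantForm (T : V →ₗ[F] V) σ ∧ σ.Nondegenerate) ↔
      ∀ f ∈ elementaryDivisors (T : V →ₗ[F] V),
        IsSelfDualPoly c f ∨
          (dualPoly c f ∈ elementaryDivisors (T : V →ₗ[F] V) ∧
            elementaryDivisorMultiplicity (T : V →ₗ[F] V) (dualPoly c f) =
              elementaryDivisorMultiplicity (T : V →ₗ[F] V) f) := by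
  classical
  have hS := (exists_isElementaryDivisors (T : V →ₗ[F] V)).choose_spec
  change IsElementaryDivisors _ (elementaryDivisors (T : V →ₗ[F] V)) at hS
  have hmult : ∀ f, elementaryDivisorMultiplicity (T : V →ₗ[F] V) f =
      (elementaryDivisors (T : V →ₗ[F] V)).count f := fun f => by
    unfold elementaryDivisorMultiplicity
    congr
  simp only [hmult]
  constructor
  · rintro ⟨σ, -, hinv, hσ⟩ f hf
    have h := count_dualPoly_of_isInvariantForm hc hinv hσ hS hf
    have hcount : (elementaryDivisors (T : V →ₗ[F] V)).count (dualPoly c f) =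
        (elementaryDivisors (T : V →ₗ[F] V)).count f := by convert h
    -- The second alternative always holds here, even for self-dual `f`.
    exact Or.inr ⟨Multiset.count_pos.1 (hcount ▸ Multiset.count_pos.2 hf), hcount⟩
  · intro h
    refine exists_hermitian_invariant_form_of_count hc hc_ne T.surjective hS fun f hf => ?_
    rcases h f hf with h | h
    · rw [h.dualPoly_eq]
    · convert h.2
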